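/- **Conventions.** A (linear) permutation of length $n\ge 0$ is a sequence $\pi=\pi_1\cdots\pi_n$ of $n$ distinct positive integers; $|\pi|=n$. The cyclic permutation $[\pi]$ is the set of all rotations of $\pi$. Write $[n]=\{1,\dots,n\}$. The cyclic descent set of $\pi$ is $\operatorname{cDes}\pi=\{i\in[n]:\pi_i>\pi_{i+1}\}$, with indices modulo $n$, and $\operatorname{cDes}[\pi]$ is the multiset $\{\{\operatorname{cDes}\bar\pi:\bar\pi\in[\pi]\}\}$. For $S\subseteq[n]$ and an integer $i$, the cyclic shift is $S+i=\{s+i:s\in S\}$, with values modulo $n$ in $[n]$; the class $[S]$ of $S$ under cyclic shift is identified with the multiset $\{\{S+i:i\in[n]\}\}$ (with $\{\{\emptyset\}\}$ if $n=0$). $S\subseteq[n]$ is *non-Escher* if $S=\operatorname{cDes}\pi$ for some permutation $\pi$ of length $n$. Permutations are *disjoint* if they have no common letter. For disjoint $\pi,\sigma$, the set $[\pi]\sqcup\!\sqcup[\sigma]$ of cyclic shuffles consists of all $[\tau]$ with $\tau$ a permutation of length $|\pi|+|\sigma|$ having some $\bar\pi\in[\pi]$ and some $\bar\sigma\in[\sigma]$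 as subsequences. In $\mathbb Q[[x_1,x_2,\dots]]$, for $S\subseteq[n-1]$ let $F_{n,S}=\sum x_{i_1}\cdots x_{i_n}$, over all $i_1\le\cdots\le i_n$ with $i_j<i_{j+1}$ whenever $j\in S$. For $n\ge1$ and $S\subseteq[n]$ let $F^{\mathrm{cyc}}_{n,[S]}=F^{\mathrm{cyc}}_{n,S}=\sum_{i\in[n]}F_{n,(S+i)\cap[n-1]}$, and let $F^{\mathrm{cyc}}_{0,[\emptyset]}=1$. Let $\mathrm{cQSym}^-$ be the $\mathbb Q$-span of the $F^{\mathrm{cyc}}_{n,[S]}$ over all $n\ge0$ and all non-Escher $S\subseteq[n]$. A cyclic permutation statistic is a function $\operatorname{cst}$ on cyclic permutations with $\operatorname{cst}[\pi]=\operatorname{cst}[\sigma]$ whenever $\pi,\sigma$ have the same relative order. It is *cyclic shuffle-compatible* if, for disjoint $\pi,\sigma$, the multiset of values of $\operatorname{cst}$ over $[\pi]\sqcup\!\sqcup[\sigma]$ depends only on $\operatorname{cst}[\pi]$, $\operatorname{cst}[\sigma]$, $|\pi|$ and $|\sigma|$. In that case its *cyclic shuffle algebra* $\mathcal A^{\mathrm{cyc}}_{\operatorname{cst}}$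 is the $\mathbb Q$-algebra with basis the classes $[\pi]_{\operatorname{cst}}$ of cyclic permutations with the same length and the same value of $\operatorname{cst}$, and with product $[\pi]_{\operatorname{cst}}[\sigma]_{\operatorname{cst}}=\sum_{[\tau]\in[\pi]\sqcup\!\sqcup[\sigma]}[\tau]_{\operatorname{cst}}$ for disjoint $\pi,\sigma$. **Theorem.** 1. Let $m,n\ge0$, and let $A\subseteq[m]$ and $B\subseteq[n]$ be non-Escher. Then $$F^{\mathrm{cyc}}_{m,[A]}\,F^{\mathrm{cyc}}_{n,[B]}=\sum_{[\tau]\in[\pi]\sqcup\!\sqcup[\sigma]}F^{\mathrm{cyc}}_{m+n,\operatorname{cDes}[\tau]},$$ where $[\pi]$ is any cyclic permutation of length $m$ with $\operatorname{cDes}[\pi]=[A]$ and $[\sigma]$ is any cyclic permutation of length $n$ with $\operatorname{cDes}[\sigma]=[B]$ and $\sigma$ disjoint from $\pi$. 2. The statistic $\operatorname{cDes}$ is cyclic shuffle-compatible, $\mathrm{cQSym}^-$ is a $\mathbb Q$-subalgebra of $\mathbb Q[[x_1,x_2,\dots]]$, and the linear map on $\mathcal A^{\mathrm{cyc}}_{\operatorname{cDes}}$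 defined by $[\pi]_{\operatorname{cDes}}\mapsto F^{\mathrm{cyc}}_{|\pi|,\operatorname{cDes}[\pi]}$ is a $\mathbb Q$-algebra isomorphism from $\mathcal A^{\mathrm{cyc}}_{\operatorname{cDes}}$ to $\mathrm{cQSym}^-$. -/

import Mathlib

/-! ### Linear and cyclic permutations

A linear permutation is a duplicate-free list of positive integers; a cyclic permutation is its
class under rotation. -/

/-- Two words have the same relative order (equivalently, the same standardization). -/
def SameRelOrder (p q : List ℕ+) : Prop :=
  p.length = q.length ∧ ∀ i j, i < p.length → j < p.length →
    (p.getD i 1 < p.getD j 1 ↔ q.getD i 1 < q.getD j 1)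

/-- `t` is a shuffle of `p` and `q` (which have no common letters wherever this is used): a linear
permutation of length `|p| + |q|` having both as subsequences. -/
def IsShuffle (p q t : List ℕ+) : Prop :=
  t.Nodup ∧ t.length = p.length + q.length ∧ p.Sublist t ∧ q.Sublist t

/-- A cyclic permutation: a word with distinct letters in the positive integers, up to rotation. -/
def CyclicPerm : Type := {c : Cycle ℕ+ // c.Nodup}

namespace CyclicPerm

/-- The cyclic permutation `[p]` of a linear permutation `p`. -/
def mk (p : List ℕ+) (hp : p.Nodup) : CyclicPerm := ⟨(p : Cycle ℕ+), hp⟩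

/-- The length of a cyclic permutation. -/
def length (π : CyclicPerm) : ℕ := π.1.length

/-- Two cyclic permutations are disjoint if they have no letters in common. -/
def Disjoint (π σ : CyclicPerm) : Prop := ∀ x, x ∈ π.1 → x ∉ σ.1

/-- The empty cyclic permutation. -/
def empty : CyclicPerm := mk [] List.nodup_nil

/-- The set of cyclic shuffles of two disjoint cyclic permutations (no shuffles are considered
for permutations that are not disjoint). -/
def shuffleSet (π σ : CyclicPerm) : Set CyclicPerm :=
  {τ | Disjoint π σ ∧ ∃ p q t : List ℕ+, (p : Cycle ℕ+) = π.1 ∧ (q : Cycle ℕ+) = σ.1 ∧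
    (t : Cycle ℕ+) = τ.1 ∧ IsShuffle p q t}

theorem exists_rep (π : CyclicPerm) : ∃ (p : List ℕ+) (hp : p.Nodup), π = mk p hp := by
  obtain ⟨c, hc⟩ := π
  induction c using Quotient.inductionOn' with
  | h p => exact ⟨p, hc, rfl⟩

theorem IsShuffle_perm {p q t : List ℕ+} (hp : p.Nodup) (hq : q.Nodup)
    (hd : ∀ x, x ∈ p → x ∉ q) (h : IsShuffle p q t) : (p ++ q).Perm t := by
  obtain ⟨_, hl, hpt, hqt⟩ := h
  have hn : (p ++ q).Nodup := List.nodup_append'.2 ⟨hp, hq, fun x hx hx' => hd x hx hx'⟩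
  have hs : (p ++ q) ⊆ t := by
    intro x hx
    rcases List.mem_append.1 hx with hx | hx
    · exact hpt.subset hx
    · exact hqt.subset hx
  exact (hn.subperm hs).perm_of_length_le (by simp [hl])

theorem shuffleSet_finite (π σ : CyclicPerm) : (shuffleSet π σ).Finite := by
  obtain ⟨p₀, hp₀, rfl⟩ := exists_rep π
  obtain ⟨q₀, hq₀, rfl⟩ := exists_rep σ
  have hfin : (((fun l : List ℕ+ => (l : Cycle ℕ+)) ''
      {t | t ∈ (p₀ ++ q₀).permutations})).Finite :=
    (List.finite_toSet _).image _
  refine Set.Finite.subset (hfin.preimage (Subtype.val_injective.injOn)) ?_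
  rintro τ ⟨hd, p, q, t, hp, hq, ht, h⟩
  have hp' : p.IsRotated p₀ := Cycle.coe_eq_coe.1 hp
  have hq' : q.IsRotated q₀ := Cycle.coe_eq_coe.1 hq
  refine ⟨t, ?_, ht⟩
  have := IsShuffle_perm (hp'.nodup_iff.2 hp₀) (hq'.nodup_iff.2 hq₀)
    (fun x hx hx' => hd x (hp'.mem_iff.1 hx) (hq'.mem_iff.1 hx')) h
  exact List.mem_permutations.2 (this.symm.trans (hp'.perm.append hq'.perm))

/-- The finite set of cyclic shuffles of two disjoint cyclic permutations. -/
noncomputable def shuffle (π σ : CyclicPerm) : Finset CyclicPerm :=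
  (shuffleSet_finite π σ).toFinset

theorem mem_shuffle {π σ τ : CyclicPerm} : τ ∈ shuffle π σ ↔ τ ∈ shuffleSet π σ :=
  Set.Finite.mem_toFinset _

theorem Disjoint.symm {π σ : CyclicPerm} (h : Disjoint π σ) : Disjoint σ π :=
  fun x hx hx' => h x hx' hx

theorem shuffle_comm (π σ : CyclicPerm) : shuffle π σ = shuffle σ π := by
  ext τ
  simp only [mem_shuffle, shuffleSet, Set.mem_ofPred_eq]
  constructor
  · rintro ⟨hd, p, q, t, hp, hq, ht, h1, h2, h3, h4⟩
    exact ⟨hd.symm, q, p, t, hq, hp, ht, h1, by omega, h4, h3⟩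
  · rintro ⟨hd, p, q, t, hp, hq, ht, h1, h2, h3, h4⟩
    exact ⟨hd.symm, q, p, t, hq, hp, ht, h1, by omega, h4, h3⟩

theorem length_of_mem_shuffle {π σ τ : CyclicPerm} (h : τ ∈ shuffle π σ) :
    τ.length = π.length + σ.length := by
  obtain ⟨_, p, q, t, hp, hq, ht, h⟩ := mem_shuffle.1 h
  have := h.2.1
  simp only [length, ← hp, ← hq, ← ht, Cycle.length_coe, this]

/-- Keep only the letters of a cyclic word that lie in a given set. -/
noncomputable def restrict (P : Set ℕ+) : Cycle ℕ+ → Cycle ℕ+ := by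
  classical
  exact Quotient.map' (fun l => l.filter (· ∈ P)) (by
    intro a b h
    obtain ⟨n, rfl⟩ := h
    show (a.filter (· ∈ P)).IsRotated ((a.rotate n).filter (· ∈ P))
    rw [List.rotate_eq_drop_append_take_mod, List.filter_append]
    conv_lhs => rw [← List.take_append_drop (n % a.length) a, List.filter_append]
    exact List.isRotated_append)

open Classical in
theorem restrict_coe (P : Set ℕ+) (l : List ℕ+) :
    restrict P (l : Cycle ℕ+) = ((l.filter (· ∈ P) : List ℕ+) : Cycle ℕ+) := rfl

theorem restrict_restrict (P Q : Set ℕ+) (c : Cycle ℕ+) :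
    restrict P (restrict Q c) = restrict (P ∩ Q) c := by
  classical
  induction c using Quotient.inductionOn' with
  | h l =>
    show restrict P (restrict Q (l : Cycle ℕ+)) = restrict (P ∩ Q) (l : Cycle ℕ+)
    rw [restrict_coe, restrict_coe, restrict_coe, List.filter_filter]
    congr 1
    apply List.filter_congr
    intro x _
    simp

theorem mem_restrict {P : Set ℕ+} {c : Cycle ℕ+} {x : ℕ+} :
    x ∈ restrict P c ↔ x ∈ c ∧ x ∈ P := by
  classical
  induction c using Quotient.inductionOn' with
  | h l =>
    show x ∈ restrict P (l : Cycle ℕ+) ↔ x ∈ (l : Cycle ℕ+) ∧ x ∈ P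
    rw [restrict_coe, Cycle.mem_coe_iff, Cycle.mem_coe_iff, List.mem_filter]
    simp

theorem nodup_restrict (P : Set ℕ+) {c : Cycle ℕ+} (h : c.Nodup) : (restrict P c).Nodup := by
  classical
  induction c using Quotient.inductionOn' with
  | h l => exact List.Nodup.filter _ h

/-- The letters of a cyclic permutation. -/
def letters (π : CyclicPerm) : Set ℕ+ := {x | x ∈ π.1}

/-- Cyclic shuffles are recognised by their restrictions to the two sets of letters. -/
theorem mem_shuffle_iff {π σ τ : CyclicPerm} (hd : Disjoint π σ) :
    τ ∈ shuffle π σ ↔ restrict π.letters τ.1 = π.1 ∧ restrict σ.letters τ.1 = σ.1 ∧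
      τ.letters = π.letters ∪ σ.letters := by
  classical
  rw [mem_shuffle]
  constructor
  · rintro ⟨-, p, q, t, hp, hq, ht, h⟩
    have hpn : p.Nodup := by have := π.2; rw [← hp] at this; exact this
    have hqn : q.Nodup := by have := σ.2; rw [← hq] at this; exact this
    have hmp : ∀ x, x ∈ π.letters ↔ x ∈ p := fun x => by
      show x ∈ π.1 ↔ _
      rw [← hp]; rfl
    have hmq : ∀ x, x ∈ σ.letters ↔ x ∈ q := fun x => by
      show x ∈ σ.1 ↔ _
      rw [← hq]; rfl
    have hmt : ∀ x, x ∈ τ.letters ↔ x ∈ t := fun x => by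
      show x ∈ τ.1 ↔ _
      rw [← ht]; rfl
    have hperm := IsShuffle_perm hpn hqn
      (fun x hx hx' => hd x ((hmp x).2 hx) ((hmq x).2 hx')) h
    obtain ⟨htn, hl, hpt, hqt⟩ := h
    have key : ∀ r : List ℕ+, r.Sublist t → t.filter (· ∈ r) = r := by
      intro r hr
      have hrn : r.Nodup := htn.sublist hr
      have h1 : r.Sublist (t.filter (· ∈ r)) := by
        have := hr.filter (fun x => decide (x ∈ r))
        rwa [List.filter_eq_self.2 (by simp)] at this
      refine (h1.eq_of_length_le ?_).symm
      exact ((htn.filter _).subperm (fun x hx => by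
        have := (List.mem_filter.1 hx).2
        simpa using this)).length_le
    refine ⟨?_, ?_, ?_⟩
    · rw [← ht, ← hp, restrict_coe]
      congr 1
      rw [← key p hpt]
      simp only [hmp, key p hpt]
    · rw [← ht, ← hq, restrict_coe]
      congr 1
      rw [← key q hqt]
      simp only [hmq, key q hqt]
    · ext x
      rw [Set.mem_union, hmp, hmq, hmt, ← hperm.mem_iff, List.mem_append]
  · rintro ⟨h1, h2, h3⟩
    obtain ⟨t, ht, rfl⟩ := exists_rep τ
    refine ⟨hd, t.filter (· ∈ π.letters), t.filter (· ∈ σ.letters), t, ?_, ?_, rfl, ht, ?_,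
      List.filter_sublist, List.filter_sublist⟩
    · rw [← restrict_coe]; exact h1
    · rw [← restrict_coe]; exact h2
    · have : ∀ x ∈ t, x ∈ σ.letters ↔ ¬ x ∈ π.letters := by
        intro x hx
        constructor
        · exact fun hs hp => hd x hp hs
        · intro hp
          have : x ∈ (mk t ht).letters := hx
          rw [h3] at this
          exact this.resolve_left hp
      have hc : t.filter (· ∈ σ.letters) = t.filter (fun x => !decide (x ∈ π.letters)) :=
        List.filter_congr (fun x hx => by simp [this x hx])
      rw [hc]
      exact List.length_eq_length_filter_add (l := t) (fun x => decide (x ∈ π.letters))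

theorem disjoint_of_mem_shuffle {π σ ρ τ : CyclicPerm} (hd : Disjoint π σ)
    (hτ : τ ∈ shuffle π σ) (h1 : Disjoint π ρ) (h2 : Disjoint σ ρ) : Disjoint τ ρ := by
  intro x hx
  have hx' : x ∈ τ.letters := hx
  rw [((mem_shuffle_iff hd).1 hτ).2.2] at hx'
  rcases hx' with h | h
  · exact h1 x h
  · exact h2 x h

/-- The iterated cyclic shuffles of three disjoint cyclic permutations. -/
theorem mem_shuffle₃ {π σ ρ υ : CyclicPerm} (h12 : Disjoint π σ) (h13 : Disjoint π ρ)
    (h23 : Disjoint σ ρ) :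
    (∃ τ ∈ shuffle π σ, υ ∈ shuffle τ ρ) ↔ restrict π.letters υ.1 = π.1 ∧
      restrict σ.letters υ.1 = σ.1 ∧ restrict ρ.letters υ.1 = ρ.1 ∧
      υ.letters = π.letters ∪ σ.letters ∪ ρ.letters := by
  constructor
  · rintro ⟨τ, hτ, hυ⟩
    have hd := disjoint_of_mem_shuffle h12 hτ h13 h23
    obtain ⟨a1, a2, a3⟩ := (mem_shuffle_iff h12).1 hτ
    obtain ⟨b1, b2, b3⟩ := (mem_shuffle_iff hd).1 hυ
    refine ⟨?_, ?_, b2, by rw [b3, a3]⟩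
    · rw [← b1, restrict_restrict] at a1
      rwa [Set.inter_eq_left.2 (by rw [a3]; exact Set.subset_union_left)] at a1
    · rw [← b1, restrict_restrict] at a2
      rwa [Set.inter_eq_left.2 (by rw [a3]; exact Set.subset_union_right)] at a2
  · rintro ⟨h1, h2, h3, h4⟩
    let τ : CyclicPerm := ⟨restrict (π.letters ∪ σ.letters) υ.1, nodup_restrict _ υ.2⟩
    have hτl : τ.letters = π.letters ∪ σ.letters := by
      ext x
      show x ∈ restrict _ υ.1 ↔ _
      rw [mem_restrict]
      refine ⟨fun h => h.2, fun h => ⟨?_, h⟩⟩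
      have : x ∈ υ.letters := by rw [h4]; exact Or.inl h
      exact this
    have hτ : τ ∈ shuffle π σ := by
      refine (mem_shuffle_iff h12).2 ⟨?_, ?_, hτl⟩
      · show restrict _ (restrict _ _) = _
        rw [restrict_restrict, Set.inter_eq_left.2 Set.subset_union_left, h1]
      · show restrict _ (restrict _ _) = _
        rw [restrict_restrict, Set.inter_eq_left.2 Set.subset_union_right, h2]
    refine ⟨τ, hτ, (mem_shuffle_iff (disjoint_of_mem_shuffle h12 hτ h13 h23)).2 ⟨?_, h3, ?_⟩⟩
    · rw [hτl]
    · rw [hτl, h4]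

theorem sum_shuffle₃ {M : Type*} [AddCommMonoid M] (f : CyclicPerm → M) {π σ ρ : CyclicPerm}
    (h12 : Disjoint π σ) (h13 : Disjoint π ρ) (h23 : Disjoint σ ρ) :
    ∑ τ ∈ shuffle π σ, ∑ υ ∈ shuffle τ ρ, f υ = ∑ κ ∈ shuffle σ ρ, ∑ υ ∈ shuffle π κ, f υ := by
  classical
  have aux : ∀ {π σ ρ : CyclicPerm}, Disjoint π σ → Disjoint π ρ → Disjoint σ ρ →
      ((shuffle π σ : Finset CyclicPerm) : Set CyclicPerm).PairwiseDisjoint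
        (fun τ => shuffle τ ρ) := by
    intro π σ ρ h12 h13 h23 τ hτ τ' hτ' hne
    rw [Function.onFun, Finset.disjoint_left]
    intro υ h h'
    have hτ := Finset.mem_coe.1 hτ
    have hτ' := Finset.mem_coe.1 hτ'
    obtain ⟨a, -, -⟩ := (mem_shuffle_iff (disjoint_of_mem_shuffle h12 hτ h13 h23)).1 h
    obtain ⟨b, -, -⟩ := (mem_shuffle_iff (disjoint_of_mem_shuffle h12 hτ' h13 h23)).1 h'
    rw [((mem_shuffle_iff h12).1 hτ).2.2] at a
    rw [((mem_shuffle_iff h12).1 hτ').2.2] at b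
    exact hne (Subtype.ext (a.symm.trans b))
  simp_rw [shuffle_comm π]
  rw [← shuffle_comm π σ, ← Finset.sum_biUnion (aux h12 h13 h23),
    ← Finset.sum_biUnion (aux h23 h12.symm h13.symm)]
  congr 1
  ext υ
  simp only [Finset.mem_biUnion]
  rw [mem_shuffle₃ h12 h13 h23, mem_shuffle₃ h23 h12.symm h13.symm]
  rw [Set.union_comm (σ.letters ∪ ρ.letters), Set.union_assoc]
  tauto

theorem shuffle_empty (π : CyclicPerm) : shuffle empty π = {π} := by
  classical
  have hd : Disjoint empty π := fun x hx => absurd hx (Cycle.notMem_nil x)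
  have he : empty.letters = ∅ := by
    ext x
    exact iff_of_false (Cycle.notMem_nil x) (Set.notMem_empty x)
  have self : ∀ τ : CyclicPerm, restrict τ.letters τ.1 = τ.1 := by
    intro τ
    obtain ⟨t, ht, rfl⟩ := exists_rep τ
    show restrict _ (t : Cycle ℕ+) = (t : Cycle ℕ+)
    rw [restrict_coe]
    congr 1
    exact List.filter_eq_self.2 (fun x hx => decide_eq_true (show x ∈ (mk t ht).letters from hx))
  ext τ
  rw [mem_shuffle_iff hd, he, Set.empty_union, Finset.mem_singleton]
  constructor
  · rintro ⟨-, h2, h3⟩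
    rw [← h3, self] at h2
    exact Subtype.ext h2
  · rintro rfl
    refine ⟨?_, self τ, rfl⟩
    obtain ⟨t, ht, rfl⟩ := exists_rep τ
    show restrict _ (t : Cycle ℕ+) = (([] : List ℕ+) : Cycle ℕ+)
    rw [restrict_coe]
    congr 1
    simp

end CyclicPerm

/-! ### Cyclic permutation statistics -/

/-- A cyclic permutation statistic: a function on cyclic permutations whose value on `[p]` depends
only on the relative order of the letters of `p`. -/
structure CyclicStatistic (V : Type*) where
  toFun : CyclicPerm → V
  map_eq : ∀ (p q : List ℕ+) (hp : p.Nodup) (hq : q.Nodup), SameRelOrder p q →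
    toFun (CyclicPerm.mk p hp) = toFun (CyclicPerm.mk q hq)

/-- The cyclic descent set `{i ∈ [n] : p_i > p_{i+1}}` of a word of length `n`, where letters are
numbered from `1` and indices are read modulo `n`. (The entry of index `k` of a list is the letter
numbered `k + 1`, and all entries used here exist.) -/
def cDesList (p : List ℕ+) : Finset ℕ :=
  (Finset.Icc 1 p.length).filter (fun i => p.getD (i % p.length) 1 < p.getD (i - 1) 1)

/-- The cyclic descent set of a cyclic permutation: the multiset of the cyclic descent sets of its
linear representatives. -/
def cDes (π : CyclicPerm) : Multiset (Finset ℕ) := π.1.lists.map cDesList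

theorem SameRelOrder.rotate {p q : List ℕ+} (h : SameRelOrder p q) (k : ℕ) :
    SameRelOrder (p.rotate k) (q.rotate k) := by
  obtain ⟨hl, h⟩ := h
  refine ⟨by simp [hl], fun i j hi hj => ?_⟩
  simp only [List.length_rotate] at hi hj
  have aux : ∀ (l : List ℕ+) (i : ℕ), i < l.length →
      (l.rotate k).getD i 1 = l.getD ((i + k) % l.length) 1 := by
    intro l i hi
    have h1 : i < (l.rotate k).length := by simpa using hi
    have h2 : (i + k) % l.length < l.length := Nat.mod_lt _ (by omega)
    rw [List.getD_eq_getElem _ _ h1, List.getD_eq_getElem _ _ h2, List.getElem_rotate]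
  rw [aux p i hi, aux p j hj, aux q i (hl ▸ hi), aux q j (hl ▸ hj), ← hl]
  exact h _ _ (Nat.mod_lt _ (by omega)) (Nat.mod_lt _ (by omega))

theorem SameRelOrder.cDesList_eq {p q : List ℕ+} (h : SameRelOrder p q) :
    cDesList p = cDesList q := by
  obtain ⟨hl, h⟩ := h
  unfold cDesList
  rw [← hl]
  apply Finset.filter_congr
  intro i hi
  rw [Finset.mem_Icc] at hi
  exact h _ _ (Nat.mod_lt _ (by omega)) (by omega)

/-- The cyclic descent set, as a cyclic permutation statistic. -/
def cDesStat : CyclicStatistic (Multiset (Finset ℕ)) where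
  toFun := cDes
  map_eq := by
    intro p q hp hq h
    show Multiset.map cDesList (Cycle.lists (p : Cycle ℕ+)) =
      Multiset.map cDesList (Cycle.lists (q : Cycle ℕ+))
    rw [Cycle.lists_coe, Cycle.lists_coe, Multiset.map_coe, Multiset.map_coe]
    congr 1
    by_cases hp0 : p = []
    · have : q = [] := List.length_eq_zero_iff.1 (by rw [← h.1, hp0]; rfl)
      rw [hp0, this]
    · have hq0 : q ≠ [] := fun hq0 => hp0 (List.length_eq_zero_iff.1 (by rw [h.1, hq0]; rfl))
      apply List.ext_getElem
      · simp [List.length_cyclicPermutations_of_ne_nil, hp0, hq0, h.1]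
      · intro n h1 h2
        simp only [List.getElem_map, List.getElem_cyclicPermutations]
        exact (h.rotate n).cDesList_eq

namespace CyclicStatistic

variable {V : Type*} (cst : CyclicStatistic V)

/-- Cyclic shuffle-compatibility: the distribution (a multiset) of the statistic over the cyclic
shuffles of disjoint `[π]` and `[σ]` depends only on its values on `[π]` and `[σ]` and on the
lengths. -/
def IsCyclicShuffleCompatible : Prop :=
  ∀ π σ π' σ' : CyclicPerm, π.Disjoint σ → π'.Disjoint σ' →
    cst.toFun π = cst.toFun π' → cst.toFun σ = cst.toFun σ' →
    π.length = π'.length → σ.length = σ'.length →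
    (π.shuffle σ).val.map cst.toFun = (π'.shuffle σ').val.map cst.toFun

/-- `cst`-equivalence of cyclic permutations: same value and same length. -/
def setoid : Setoid CyclicPerm where
  r π σ := cst.toFun π = cst.toFun σ ∧ π.length = σ.length
  iseqv := ⟨fun _ => ⟨rfl, rfl⟩, fun h => ⟨h.1.symm, h.2.symm⟩,
    fun h h' => ⟨h.1.trans h'.1, h.2.trans h'.2⟩⟩

/-- The `cst`-equivalence classes of cyclic permutations. -/
def EqClass : Type := Quotient cst.setoid

/-- The `cst`-equivalence class of a cyclic permutation. -/
def eqClass (π : CyclicPerm) : cst.EqClass := Quotient.mk cst.setoid π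

theorem eqClass_eq {π σ : CyclicPerm} :
    cst.eqClass π = cst.eqClass σ ↔ cst.toFun π = cst.toFun σ ∧ π.length = σ.length :=
  ⟨fun h => Quotient.exact h, fun h => Quotient.sound h⟩

/-- Every class has representatives with letters beyond any given bound. -/
theorem exists_rep_gt (α : cst.EqClass) (k : ℕ+) :
    ∃ π, cst.eqClass π = α ∧ ∀ x, x ∈ π.1 → k < x := by
  induction α using Quotient.inductionOn with
  | h π =>
    obtain ⟨p, hp, rfl⟩ := CyclicPerm.exists_rep π
    have hq : (p.map (· + k)).Nodup := hp.map (add_left_injective k)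
    refine ⟨CyclicPerm.mk _ hq, cst.eqClass_eq.2 ⟨?_, ?_⟩, ?_⟩
    · apply cst.map_eq
      refine ⟨by simp, fun i j hi hj => ?_⟩
      have hi' : i < p.length := by simpa using hi
      have hj' : j < p.length := by simpa using hj
      rw [List.getD_eq_getElem _ _ hi, List.getD_eq_getElem _ _ hj,
        List.getD_eq_getElem _ _ hi', List.getD_eq_getElem _ _ hj']
      simp
    · simp [CyclicPerm.length, CyclicPerm.mk]
    · intro x hx
      have hx : x ∈ p.map (· + k) := hx
      obtain ⟨y, -, rfl⟩ := List.mem_map.1 hx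
      exact PNat.lt_add_left k y

theorem exists_bound (π : CyclicPerm) : ∃ k : ℕ+, ∀ x, x ∈ π.1 → x ≤ k := by
  obtain ⟨p, hp, rfl⟩ := CyclicPerm.exists_rep π
  obtain ⟨k, hk⟩ := (List.finite_toSet p).bddAbove
  exact ⟨k, fun x hx => hk hx⟩

theorem exists_disjoint (α β γ : cst.EqClass) : ∃ π σ ρ : CyclicPerm,
    cst.eqClass π = α ∧ cst.eqClass σ = β ∧ cst.eqClass ρ = γ ∧
    π.Disjoint σ ∧ π.Disjoint ρ ∧ σ.Disjoint ρ := by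
  obtain ⟨π, hπ, -⟩ := cst.exists_rep_gt α 1
  obtain ⟨k, hk⟩ := exists_bound π
  obtain ⟨σ, hσ, hσk⟩ := cst.exists_rep_gt β k
  obtain ⟨l, hl⟩ := exists_bound σ
  obtain ⟨ρ, hρ, hρl⟩ := cst.exists_rep_gt γ (max k l)
  refine ⟨π, σ, ρ, hπ, hσ, hρ, fun x h h' => ?_, fun x h h' => ?_, fun x h h' => ?_⟩
  · exact absurd (hk x h) (not_le.2 (hσk x h'))
  · exact absurd ((hk x h).trans (le_max_left k l)) (not_le.2 (hρl x h'))
  · exact absurd ((hl x h).trans (le_max_right k l)) (not_le.2 (hρl x h'))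

theorem exists_disjoint₂ (α β : cst.EqClass) : ∃ r : CyclicPerm × CyclicPerm,
    cst.eqClass r.1 = α ∧ cst.eqClass r.2 = β ∧ r.1.Disjoint r.2 := by
  obtain ⟨π, σ, -, h1, h2, -, h3, -⟩ := cst.exists_disjoint α β β
  exact ⟨(π, σ), h1, h2, h3⟩

/-- The sum of the classes of the cyclic shuffles of `[π]` and `[σ]`, as a formal linear combination
of classes. -/
noncomputable def shuffleSum (π σ : CyclicPerm) : cst.EqClass →₀ ℚ :=
  ∑ τ ∈ π.shuffle σ, Finsupp.single (cst.eqClass τ) 1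

/-- The product of two basis elements, through some disjoint representatives. For a cyclic
shuffle-compatible statistic the choice does not matter, see `single_mul_single` below. -/
noncomputable def mulBasis (α β : cst.EqClass) : cst.EqClass →₀ ℚ :=
  cst.shuffleSum (cst.exists_disjoint₂ α β).choose.1 (cst.exists_disjoint₂ α β).choose.2

variable {cst}

theorem shuffleSum_congr (h : cst.IsCyclicShuffleCompatible) {π σ π' σ' : CyclicPerm}
    (hd : π.Disjoint σ) (hd' : π'.Disjoint σ') (h1 : cst.eqClass π = cst.eqClass π')
    (h2 : cst.eqClass σ = cst.eqClass σ') : cst.shuffleSum π σ = cst.shuffleSum π' σ' := by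
  rw [cst.eqClass_eq] at h1 h2
  have hm := h π σ π' σ' hd hd' h1.1 h2.1 h1.2 h2.2
  rw [← Multiset.rel_eq, Multiset.rel_map] at hm
  have hm' : Multiset.Rel (fun τ τ' => cst.eqClass τ = cst.eqClass τ')
      (π.shuffle σ).val (π'.shuffle σ').val := by
    refine hm.mono (fun τ hτ τ' hτ' he => cst.eqClass_eq.2 ⟨he, ?_⟩)
    rw [CyclicPerm.length_of_mem_shuffle hτ, CyclicPerm.length_of_mem_shuffle hτ', h1.2, h2.2]
  rw [← Multiset.rel_map (p := (· = ·)), Multiset.rel_eq] at hm'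
  have := congrArg (fun s => (s.map (fun α => Finsupp.single α (1 : ℚ))).sum) hm'
  rw [Multiset.map_map, Multiset.map_map] at this
  exact this

theorem mulBasis_eq (h : cst.IsCyclicShuffleCompatible) {π σ : CyclicPerm} (hd : π.Disjoint σ) :
    cst.mulBasis (cst.eqClass π) (cst.eqClass σ) = cst.shuffleSum π σ := by
  obtain ⟨h1, h2, h3⟩ := (cst.exists_disjoint₂ (cst.eqClass π) (cst.eqClass σ)).choose_spec
  exact shuffleSum_congr h h3 hd h1 h2

/-- The cyclic shuffle algebra of a cyclic shuffle-compatible statistic: formal rational linear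
combinations of `cst`-equivalence classes of cyclic permutations. -/
def ShuffleAlgebra (_h : cst.IsCyclicShuffleCompatible) : Type := cst.EqClass →₀ ℚ

namespace ShuffleAlgebra

variable (h : cst.IsCyclicShuffleCompatible)

noncomputable instance : AddCommGroup (ShuffleAlgebra h) :=
  inferInstanceAs (AddCommGroup (cst.EqClass →₀ ℚ))

noncomputable instance : Module ℚ (ShuffleAlgebra h) :=
  inferInstanceAs (Module ℚ (cst.EqClass →₀ ℚ))

/-- The basis element given by the class of a cyclic permutation. -/
noncomputable def of (π : CyclicPerm) : ShuffleAlgebra h :=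
  (Finsupp.single (cst.eqClass π) 1 : cst.EqClass →₀ ℚ)

/-- The bilinear extension of the product of basis elements. -/
noncomputable def mulLin :
    ShuffleAlgebra h →ₗ[ℚ] ShuffleAlgebra h →ₗ[ℚ] ShuffleAlgebra h :=
  Finsupp.linearCombination ℚ (M := (cst.EqClass →₀ ℚ) →ₗ[ℚ] (cst.EqClass →₀ ℚ))
    (fun α => Finsupp.linearCombination ℚ (cst.mulBasis α))

/-- The defining rule of the product. -/
theorem mulLin_of {π σ : CyclicPerm} (hd : π.Disjoint σ) :
    mulLin h (of h π) (of h σ) = ∑ τ ∈ π.shuffle σ, of h τ := by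
  have h1 : mulLin h (of h π) (of h σ) = cst.mulBasis (cst.eqClass π) (cst.eqClass σ) := by
    have e1 := Finsupp.linearCombination_single ℚ
      (v := fun α => Finsupp.linearCombination ℚ (cst.mulBasis α)) 1 (cst.eqClass π)
    have e2 := Finsupp.linearCombination_single ℚ
      (v := cst.mulBasis (cst.eqClass π)) 1 (cst.eqClass σ)
    rw [one_smul] at e1 e2
    exact (LinearMap.congr_fun e1 _).trans e2
  rw [h1, mulBasis_eq h hd]
  rfl

/-- Linear maps out of the cyclic shuffle algebra agree if they agree on basis elements. -/
theorem lin_ext {M : Type*} [AddCommMonoid M] [Module ℚ M] {f g : ShuffleAlgebra h →ₗ[ℚ] M}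
    (hfg : ∀ π, f (of h π) = g (of h π)) : f = g := by
  refine Finsupp.lhom_ext' (fun α => LinearMap.ext_ring ?_)
  induction α using Quotient.inductionOn with
  | h π => exact hfg π

theorem mulLin_assoc (x y z : ShuffleAlgebra h) :
    mulLin h (mulLin h x y) z = mulLin h x (mulLin h y z) := by
  have key : ∀ α β γ : cst.EqClass,
      mulLin h (mulLin h (Finsupp.single α 1 : cst.EqClass →₀ ℚ)
        (Finsupp.single β 1 : cst.EqClass →₀ ℚ)) (Finsupp.single γ 1 : cst.EqClass →₀ ℚ) =
      mulLin h (Finsupp.single α 1 : cst.EqClass →₀ ℚ)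
        (mulLin h (Finsupp.single β 1 : cst.EqClass →₀ ℚ)
          (Finsupp.single γ 1 : cst.EqClass →₀ ℚ)) := by
    intro α β γ
    obtain ⟨π, σ, ρ, rfl, rfl, rfl, h12, h13, h23⟩ := cst.exists_disjoint α β γ
    show mulLin h (mulLin h (of h π) (of h σ)) (of h ρ) =
      mulLin h (of h π) (mulLin h (of h σ) (of h ρ))
    rw [mulLin_of h h12, mulLin_of h h23, map_sum, map_sum, LinearMap.sum_apply]
    have e1 : ∀ τ ∈ π.shuffle σ, mulLin h (of h τ) (of h ρ) = ∑ υ ∈ τ.shuffle ρ, of h υ :=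
      fun τ hτ => mulLin_of h (CyclicPerm.disjoint_of_mem_shuffle h12 hτ h13 h23)
    have e2 : ∀ κ ∈ σ.shuffle ρ, mulLin h (of h π) (of h κ) = ∑ υ ∈ π.shuffle κ, of h υ :=
      fun κ hκ => mulLin_of h
        (CyclicPerm.disjoint_of_mem_shuffle h23 hκ h12.symm h13.symm).symm
    rw [Finset.sum_congr rfl e1, Finset.sum_congr rfl e2]
    exact CyclicPerm.sum_shuffle₃ _ h12 h13 h23
  have e : (mulLin h).compr₂ (mulLin h) =
      (LinearMap.llcomp ℚ _ _ _).flip (mulLin h) ∘ₗ (LinearMap.llcomp ℚ _ _ _) ∘ₗ mulLin h := by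
    refine lin_ext h fun π => lin_ext h fun σ => lin_ext h fun ρ => ?_
    exact key (cst.eqClass π) (cst.eqClass σ) (cst.eqClass ρ)
  exact LinearMap.congr_fun (LinearMap.congr_fun (LinearMap.congr_fun e x) y) z

theorem mulLin_comm (x y : ShuffleAlgebra h) : mulLin h x y = mulLin h y x := by
  have e : mulLin h = (mulLin h).flip := by
    refine lin_ext h fun π => lin_ext h fun σ => ?_
    obtain ⟨⟨π', σ'⟩, h1, h2, h3⟩ := cst.exists_disjoint₂ (cst.eqClass π) (cst.eqClass σ)
    have e1 : of h π = of h π' := by unfold of; rw [← h1]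
    have e2 : of h σ = of h σ' := by unfold of; rw [← h2]
    rw [LinearMap.flip_apply, e1, e2, mulLin_of h h3, mulLin_of h h3.symm,
      CyclicPerm.shuffle_comm]
  exact LinearMap.congr_fun (LinearMap.congr_fun e x) y

theorem mulLin_one (x : ShuffleAlgebra h) : mulLin h (of h CyclicPerm.empty) x = x := by
  have e : mulLin h (of h CyclicPerm.empty) = LinearMap.id := by
    refine lin_ext h fun π => ?_
    rw [mulLin_of h (fun x hx => absurd hx (Cycle.notMem_nil x)), CyclicPerm.shuffle_empty,
      Finset.sum_singleton, LinearMap.id_apply]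
  exact LinearMap.congr_fun e x

/-- The ring structure: the product is the bilinear one with
`[π]_cst [σ]_cst = ∑ [τ]_cst` over the cyclic shuffles `[τ]` of disjoint `[π]` and `[σ]`, and the
unit is the class of the empty permutation. -/
noncomputable instance : CommRing (ShuffleAlgebra h) :=
  { (inferInstance : AddCommGroup (ShuffleAlgebra h)) with
    mul := fun x y => mulLin h x y
    one := of h CyclicPerm.empty
    left_distrib := fun x y z => map_add (mulLin h x) y z
    right_distrib := fun x y z => LinearMap.map_add₂ (mulLin h) x y z
    zero_mul := fun x => LinearMap.map_zero₂ (mulLin h) x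
    mul_zero := fun x => map_zero (mulLin h x)
    mul_assoc := mulLin_assoc h
    mul_comm := mulLin_comm h
    one_mul := mulLin_one h
    mul_one := fun x => (mulLin_comm h x _).trans (mulLin_one h x) }

noncomputable instance : Algebra ℚ (ShuffleAlgebra h) :=
  Algebra.ofModule (fun r x y => LinearMap.map_smul₂ (mulLin h) r x y)
    (fun r x y => map_smul (mulLin h x) r y)

/-- The multiplication rule that defines the cyclic shuffle algebra. -/
theorem of_mul_of {π σ : CyclicPerm} (hd : π.Disjoint σ) :
    of h π * of h σ = ∑ τ ∈ π.shuffle σ, of h τ :=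
  mulLin_of h hd

end ShuffleAlgebra

end CyclicStatistic

/-! ### Fundamental (cyclic) quasisymmetric functions

Power series over `ℚ` in the variables `x_1, x_2, …`. Subsets of `[n]` are finite sets of
natural numbers contained in `{1, …, n}`. -/

/-- The fundamental quasisymmetric function `F_{n,S} = ∑ x_{i_1} ⋯ x_{i_n}`, over all
`i_1 ≤ ⋯ ≤ i_n` with `i_j < i_{j+1}` whenever `j ∈ S`: the coefficient of a monomial is the number
of such index sequences that yield it (there is at most one). -/
noncomputable def fundamentalQSym (n : ℕ) (S : Finset ℕ) : MvPowerSeries ℕ+ ℚ :=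
  fun d => (Nat.card {i : Fin n → ℕ+ // Monotone i ∧
    (∀ a b : Fin n, (b : ℕ) = a + 1 → (a : ℕ) + 1 ∈ S → i a < i b) ∧
    ∑ a, Finsupp.single (i a) 1 = d} : ℚ)

/-- The cyclic shift `S + i` of a subset `S` of `[n]`: elements are increased by `i` and reduced
modulo `n` into `{1, …, n}`. -/
def cyclicShift (n : ℕ) (S : Finset ℕ) (i : ℕ) : Finset ℕ :=
  S.image (fun s => (s + i - 1) % n + 1)

/-- The class `[S]` of a subset `S` of `[n]` under cyclic shift, recorded as the multiset of the
shifts `S + i` for `i ∈ [n]` (and as the multiset with the only element `S` if `n = 0`). -/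
def shiftClass (n : ℕ) (S : Finset ℕ) : Multiset (Finset ℕ) :=
  if n = 0 then {S} else (Finset.Icc 1 n).val.map (cyclicShift n S)

/-- The fundamental cyclic quasisymmetric function `F_{n,S}^cyc`. -/
noncomputable def fundamentalCQSym (n : ℕ) (S : Finset ℕ) : MvPowerSeries ℕ+ ℚ :=
  if n = 0 then 1
  else ∑ i ∈ Finset.Icc 1 n, fundamentalQSym n (cyclicShift n S i ∩ Finset.Icc 1 (n - 1))

/-- The function `F_{n,[S]}^cyc` of a class of subsets of `[n]` under cyclic shift. -/
noncomputable def fundamentalCQSymClass (n : ℕ) (M : Multiset (Finset ℕ)) : MvPowerSeries ℕ+ ℚ :=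
  if n = 0 then 1
  else (M.map (fun T => fundamentalQSym n (T ∩ Finset.Icc 1 (n - 1)))).sum

/-- On the class of `S`, the value is `F_{n,S}^cyc`. -/
theorem fundamentalCQSymClass_shiftClass (n : ℕ) (S : Finset ℕ) :
    fundamentalCQSymClass n (shiftClass n S) = fundamentalCQSym n S := by
  unfold fundamentalCQSymClass shiftClass fundamentalCQSym
  split_ifs
  · rfl
  · rw [Multiset.map_map]
    rfl

/-- `S` is a non-Escher subset of `[n]`: the cyclic descent set of some linear permutation of
length `n`. -/
def IsNonEscher (n : ℕ) (S : Finset ℕ) : Prop :=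
  ∃ p : List ℕ+, p.Nodup ∧ p.length = n ∧ cDesList p = S

/-- `cQSym⁻`: the span of the `F_{n,[S]}^cyc` over all `n` and all non-Escher subsets `S` of `[n]`. -/
noncomputable def cQSymMinus : Submodule ℚ (MvPowerSeries ℕ+ ℚ) :=
  Submodule.span ℚ {f | ∃ (n : ℕ) (S : Finset ℕ), IsNonEscher n S ∧
    f = fundamentalCQSymClass n (shiftClass n S)}

/-! ### Sorted biwords

A biword is a list of pairs of positive integers; the first components are thought of as indices of
variables and the second ones as the letters of a permutation. -/

/-! Pair an index sequence `i` with the letters of a permutation `p`. The pairs `(i_a, p_a)`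
increase strictly in the lexicographic order exactly when `i` is weakly increasing and rises
strictly at every descent of `p`. Hence a coefficient of the fundamental quasisymmetric function of
`p` counts increasing biwords with label word `p` and prescribed weight (`coeff_fundamentalQSym`).
Summing over rotations, the cyclic function of `[π]` counts increasing biwords whose label word is
any rotation of `π` (`coeff_cyclicQSym`).

The product rule becomes a bijection. An increasing biword is determined by its set of pairs, so one
over `[π]` and one over `[σ]` merge by sorting into a unique increasing biword, labelled by a cyclic
shuffle; keeping only the letters of `π`, or of `σ`, undoes the merge
(`sum_antidiagonal_ncard_cyclicOver`).

The functions of distinct `cDes`-classes are linearly independent (`linearIndependent_classQSym`),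
by a triangularity argument on the number of cyclic descents. Shuffle-compatibility follows: the
product of two series depends only on the classes of the factors, and its expansion in independent
series reveals how often each class occurs among the shuffles. The map to power series is then
multiplicative and injective, and its image is the required span because the classes of non-Escher
sets are exactly the values of `cDes` (`cDes_mk`). -/

namespace Biword

/-- The word formed by the second components. -/
def labels (L : List (ℕ+ ×ₗ ℕ+)) : List ℕ+ := L.map fun e => (ofLex e).2

/-- The exponent vector of the monomial formed by the first components. -/
noncomputable def weight (L : List (ℕ+ ×ₗ ℕ+)) : ℕ+ →₀ ℕ :=
  Multiset.toFinsupp (L.map fun e => (ofLex e).1 : Multiset ℕ+)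

/-- The lexicographically increasing biwords with given labels and weight. -/
def sortedOver (p : List ℕ+) (d : ℕ+ →₀ ℕ) : Set (List (ℕ+ ×ₗ ℕ+)) :=
  {L | L.SortedLT ∧ labels L = p ∧ weight L = d}

theorem length_labels (L : List (ℕ+ ×ₗ ℕ+)) : (labels L).length = L.length := List.length_map _

theorem labels_filter (f : ℕ+ → Bool) (L : List (ℕ+ ×ₗ ℕ+)) :
    labels (L.filter fun e => f (ofLex e).2) = (labels L).filter f := by
  rw [labels, labels, List.filter_map]
  rfl

theorem weight_eq_of_perm {L M : List (ℕ+ ×ₗ ℕ+)} (h : L.Perm M) : weight L = weight M := by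
  unfold weight
  rw [Multiset.coe_eq_coe.2 (h.map _)]

theorem weight_append (L M : List (ℕ+ ×ₗ ℕ+)) : weight (L ++ M) = weight L + weight M := by
  unfold weight
  rw [List.map_append, ← Multiset.coe_add, Multiset.toFinsupp_add]

theorem weight_ofFn {n : ℕ} (f : Fin n → ℕ+ ×ₗ ℕ+) :
    weight (List.ofFn f) = ∑ a, Finsupp.single (ofLex (f a)).1 1 := by
  induction n with
  | zero => simp [weight]
  | succ n ih =>
    rw [Fin.sum_univ_succ, ← ih, List.ofFn_succ, ← List.singleton_append, weight_append]
    simp [weight]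

theorem eq_of_sortedLT_of_perm {L M : List (ℕ+ ×ₗ ℕ+)} (hL : L.SortedLT) (hM : M.SortedLT)
    (h : L.Perm M) : L = M :=
  h.eq_of_sortedLE hL.sortedLE hM.sortedLE

/-- An increasing biword is recovered by sorting its set of entries, and these lie in the finite
product of the support of `d` and the letters of `p`. -/
theorem sortedOver_finite (p : List ℕ+) (d : ℕ+ →₀ ℕ) : (sortedOver p d).Finite := by
  classical
  refine Set.Finite.subset (List.finite_toSet
    (((d.support ×ˢ p.toFinset).map toLex.toEmbedding).powerset.toList.map
      fun s => s.sort (· ≤ ·))) ?_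
  rintro L ⟨h1, rfl, rfl⟩
  refine List.mem_map.2 ⟨L.toFinset, Finset.mem_toList.2 (Finset.mem_powerset.2 ?_), ?_⟩
  · intro e he
    have he : e ∈ L := List.mem_toFinset.1 he
    refine Finset.mem_map.2 ⟨ofLex e, Finset.mem_product.2 ⟨?_, ?_⟩, rfl⟩
    · rw [weight, Multiset.toFinsupp_support, Multiset.mem_toFinset, Multiset.mem_coe]
      exact List.mem_map.2 ⟨e, he, rfl⟩
    · exact List.mem_toFinset.2 (List.mem_map.2 ⟨e, he, rfl⟩)
  · refine eq_of_sortedLT_of_perm (Finset.sortedLT_sort _) h1 ?_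
    refine (List.perm_ext_iff_of_nodup (Finset.sort_nodup _ _) h1.nodup).2 fun e => ?_
    rw [Finset.mem_sort, List.mem_toFinset]

/-- Only neighbours need comparing: at an ascent of `w` the lexicographic order tolerates equal
indices, at a descent it forces a strict rise. Injectivity of `w` rules out equal neighbouring
letters. -/
theorem strictMono_toLex_iff {n : ℕ} {i w : Fin n → ℕ+} (hw : Function.Injective w) :
    StrictMono (fun a => toLex (i a, w a)) ↔
      Monotone i ∧ ∀ a b : Fin n, (b : ℕ) = a + 1 → w b < w a → i a < i b := by
  constructor
  · intro h
    refine ⟨fun a b hab => ?_, fun a b hab hwb => ?_⟩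
    · rcases hab.eq_or_lt with rfl | hab
      · exact le_rfl
      · rcases Prod.Lex.lt_iff.1 (h hab) with h' | h'
        · exact h'.le
        · exact h'.1.le
    · have hab : a < b := Fin.lt_def.2 (by omega)
      rcases Prod.Lex.lt_iff.1 (h hab) with h' | h'
      · exact h'
      · exact absurd h'.2 hwb.asymm
  · rintro ⟨h1, h2⟩
    cases n with
    | zero => exact fun a => a.elim0
    | succ n =>
      refine Fin.strictMono_iff_lt_succ.2 fun a => Prod.Lex.lt_iff.2 ?_
      have hlt : a.castSucc < a.succ := Fin.castSucc_lt_succ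
      rcases (h1 hlt.le).lt_or_eq with h | h
      · exact Or.inl h
      · refine Or.inr ⟨h, lt_of_not_ge fun h' => ?_⟩
        have h3 : w a.succ < w a.castSucc := lt_of_le_of_ne h' (hw.ne hlt.ne')
        exact absurd (h2 _ _ (by simp) h3) h.not_lt

/-! ### Coefficients as numbers of increasing biwords -/

theorem mem_cDesList_iff {p : List ℕ+} {a : ℕ} (h : a + 1 < p.length) :
    a + 1 ∈ cDesList p ↔ p[a + 1] < p[a] := by
  unfold cDesList
  rw [Finset.mem_filter, Finset.mem_Icc, Nat.mod_eq_of_lt h, Nat.add_sub_cancel,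
    List.getD_eq_getElem _ _ h, List.getD_eq_getElem _ _ (by omega)]
  exact ⟨fun h => h.2, fun h' => ⟨⟨by omega, by omega⟩, h'⟩⟩

/-- The bijection attaches the letters of `p` to an index sequence. Intersecting with `[n-1]`
discards the wrap-around descent, which the linear order of a biword does not see. -/
theorem coeff_fundamentalQSym {p : List ℕ+} (hp : p.Nodup) (d : ℕ+ →₀ ℕ) :
    MvPowerSeries.coeff d
        (fundamentalQSym p.length (cDesList p ∩ Finset.Icc 1 (p.length - 1))) =
      (sortedOver p d).ncard := by
  rw [MvPowerSeries.coeff_apply, fundamentalQSym, ← Nat.card_coe_set_eq]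
  congr 1
  have hw : Function.Injective p.get := List.nodup_iff_injective_get.1 hp
  have hmono : ∀ i : Fin p.length → ℕ+, StrictMono (fun a => toLex (i a, p.get a)) ↔
      Monotone i ∧ ∀ a b : Fin p.length, (b : ℕ) = a + 1 →
        (a : ℕ) + 1 ∈ cDesList p ∩ Finset.Icc 1 (p.length - 1) → i a < i b := by
    intro i
    rw [strictMono_toLex_iff hw]
    refine and_congr_right fun _ => forall₂_congr fun a b => forall_congr' fun hab => ?_
    have hlt : (a : ℕ) + 1 < p.length := hab ▸ b.2
    have e : p.get b = p[(a : ℕ) + 1] := by simp [hab]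
    rw [Finset.mem_inter, mem_cDesList_iff hlt, Finset.mem_Icc, e]
    refine imp_congr_left ⟨fun h => ⟨h, by omega, by omega⟩, fun h => h.1⟩
  refine Nat.card_eq_of_bijective
    (fun i => ⟨List.ofFn fun a => toLex (i.1 a, p.get a), ?_, ?_, ?_⟩) ⟨?_, ?_⟩
  · exact List.sortedLT_ofFn_iff.2 ((hmono i.1).2 ⟨i.2.1, i.2.2.1⟩)
  · rw [labels, List.map_ofFn]
    exact List.ofFn_get p
  · rw [weight_ofFn]
    exact i.2.2.2
  · intro i j hij
    have := List.ofFn_injective (Subtype.ext_iff.1 hij)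
    refine Subtype.ext (funext fun a => ?_)
    exact (Prod.ext_iff.1 (congrFun this a)).1
  · rintro ⟨L, h1, rfl, rfl⟩
    have hl : (labels L).length = L.length := length_labels L
    let i : Fin (labels L).length → ℕ+ := fun a => (ofLex (L.get (a.cast hl))).1
    have hL : List.ofFn (fun a => toLex (i a, (labels L).get a)) = L := by
      refine List.ext_getElem (by simp [hl]) fun k hk hk' => ?_
      simp only [i, labels, List.getElem_ofFn, List.get_eq_getElem, List.getElem_map]
      rfl
    have h1' := h1
    rw [← hL] at h1'
    have hm := (hmono i).1 (List.sortedLT_ofFn_iff.1 h1')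
    refine ⟨⟨i, hm.1, hm.2, ?_⟩, Subtype.ext hL⟩
    conv_rhs => rw [← hL]
    rw [weight_ofFn]
    rfl

/-- The lexicographically increasing biwords of given weight whose label word represents a given
cyclic permutation. -/
def cyclicOver (π : CyclicPerm) (d : ℕ+ →₀ ℕ) : Set (List (ℕ+ ×ₗ ℕ+)) :=
  {L | L.SortedLT ∧ (labels L : Cycle ℕ+) = π.1 ∧ weight L = d}

theorem cyclicOver_eq_biUnion (π : CyclicPerm) (d : ℕ+ →₀ ℕ) :
    cyclicOver π d = ⋃ p ∈ π.1.lists.toFinset, sortedOver p d := by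
  ext L
  simp only [cyclicOver, sortedOver, Set.mem_iUnion, Multiset.mem_toFinset,
    Cycle.mem_lists_iff_coe_eq, Set.mem_ofPred_eq, exists_prop]
  constructor
  · exact fun h => ⟨_, h.2.1, h.1, rfl, h.2.2⟩
  · rintro ⟨p, h, h1, rfl, h2⟩
    exact ⟨h1, h, h2⟩

theorem cyclicOver_finite (π : CyclicPerm) (d : ℕ+ →₀ ℕ) : (cyclicOver π d).Finite := by
  rw [cyclicOver_eq_biUnion]
  exact Set.Finite.biUnion (Finset.finite_toSet _) fun p _ => sortedOver_finite p d

/-- The sets over different rotations are disjoint because a biword determines its label word. -/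
theorem ncard_cyclicOver (π : CyclicPerm) (d : ℕ+ →₀ ℕ) :
    (cyclicOver π d).ncard = ∑ p ∈ π.1.lists.toFinset, (sortedOver p d).ncard := by
  classical
  have hfin := fun p => sortedOver_finite p d
  have : cyclicOver π d =
      ((π.1.lists.toFinset.biUnion fun p => (hfin p).toFinset : Finset _) : Set _) := by
    rw [cyclicOver_eq_biUnion]
    simp
  rw [this, Set.ncard_coe_finset, Finset.card_biUnion]
  · exact Finset.sum_congr rfl fun p _ => (Set.ncard_eq_toFinset_card _ (hfin p)).symm
  · intro p _ q _ hpq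
    refine Finset.disjoint_left.2 fun L h h' => hpq ?_
    rw [Set.Finite.mem_toFinset] at h h'
    exact h.2.1.symm.trans h'.2.1

end Biword

/-! ### Cyclic quasisymmetric functions of cyclic permutations -/

namespace CyclicPerm

theorem nodup_of_mem_lists {π : CyclicPerm} {p : List ℕ+} (h : p ∈ π.1.lists) : p.Nodup := by
  have := π.2
  rwa [← Cycle.mem_lists_iff_coe_eq.1 h] at this

theorem length_of_mem_lists {π : CyclicPerm} {p : List ℕ+} (h : p ∈ π.1.lists) :
    p.length = π.length := by
  rw [length, ← Cycle.mem_lists_iff_coe_eq.1 h, Cycle.length_coe]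

/-- Distinct letters make the rotations distinct, so sums over the multiset of representatives can
be taken over a finset. -/
theorem nodup_lists (π : CyclicPerm) : π.1.lists.Nodup := by
  obtain ⟨p, hp, rfl⟩ := exists_rep π
  exact Multiset.coe_nodup.2 hp.cyclicPermutations

theorem lists_eq_of_length_eq_zero {π : CyclicPerm} (h : π.length = 0) : π.1.lists = {[]} := by
  obtain ⟨p, hp, rfl⟩ := exists_rep π
  obtain rfl : p = [] := List.length_eq_zero_iff.1 h
  rfl

/-- The fundamental cyclic quasisymmetric function of `cDes π`. -/
noncomputable def cyclicQSym (π : CyclicPerm) : MvPowerSeries ℕ+ ℚ :=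
  fundamentalCQSymClass π.length (cDes π)

theorem cyclicQSym_eq_sum (π : CyclicPerm) : π.cyclicQSym = ∑ p ∈ π.1.lists.toFinset,
    fundamentalQSym p.length (cDesList p ∩ Finset.Icc 1 (p.length - 1)) := by
  classical
  have key : ∀ f : List ℕ+ → MvPowerSeries ℕ+ ℚ,
      ∑ p ∈ π.1.lists.toFinset, f p = (π.1.lists.map f).sum := fun f => by
    rw [Finset.sum, Multiset.toFinset_val, (nodup_lists π).dedup]
  unfold cyclicQSym fundamentalCQSymClass
  split_ifs with h
  -- In length zero the cyclic function is 1 by convention. This agrees with the count: the only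
  -- biword is the empty one, of weight zero.
  · rw [key, lists_eq_of_length_eq_zero h]
    ext d
    rw [Multiset.map_singleton, Multiset.sum_singleton,
      Biword.coeff_fundamentalQSym List.nodup_nil, MvPowerSeries.coeff_one]
    have hL : ∀ L : List (ℕ+ ×ₗ ℕ+), Biword.labels L = [] ↔ L = [] := fun L => List.map_eq_nil_iff
    have h0 : Biword.weight [] = 0 := by simp [Biword.weight]
    split_ifs with hd
    · have : Biword.sortedOver [] d = {[]} := by
        ext L
        simp only [Biword.sortedOver, Set.mem_ofPred_eq, hL, Set.mem_singleton_iff]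
        refine ⟨fun h => h.2.1, ?_⟩
        rintro rfl
        exact ⟨by simp [List.sortedLT_iff_pairwise], rfl, by rw [h0, hd]⟩
      rw [this]
      simp
    · have : Biword.sortedOver [] d = ∅ := by
        refine Set.eq_empty_iff_forall_notMem.2 ?_
        rintro L ⟨-, h1, h2⟩
        rw [hL] at h1
        subst h1
        exact hd (h2.symm.trans h0)
      rw [this]
      simp
  · rw [key, cDes, Multiset.map_map]
    congr 1
    refine Multiset.map_congr rfl fun p hp => ?_
    simp only [Function.comp, length_of_mem_lists hp]

theorem coeff_cyclicQSym (π : CyclicPerm) (d : ℕ+ →₀ ℕ) :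
    MvPowerSeries.coeff d π.cyclicQSym = (Biword.cyclicOver π d).ncard := by
  rw [cyclicQSym_eq_sum, map_sum, Biword.ncard_cyclicOver, Nat.cast_sum]
  refine Finset.sum_congr rfl fun p hp => ?_
  exact Biword.coeff_fundamentalQSym (nodup_of_mem_lists (Multiset.mem_toFinset.1 hp)) d

end CyclicPerm

/-! ### The merging bijection and the product rule -/

namespace Biword

theorem mem_labels {L : List (ℕ+ ×ₗ ℕ+)} {e : ℕ+ ×ₗ ℕ+} (h : e ∈ L) : (ofLex e).2 ∈ labels L :=
  List.mem_map.2 ⟨e, h, rfl⟩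

theorem labels_mem_letters_iff {π : CyclicPerm} {d : ℕ+ →₀ ℕ} {L : List (ℕ+ ×ₗ ℕ+)}
    (h : L ∈ cyclicOver π d) (x : ℕ+) : x ∈ labels L ↔ x ∈ π.letters := by
  show _ ↔ x ∈ π.1
  rw [← h.2.1]
  rfl

open Classical in
/-- Lexicographically increasing biwords over the cyclic shuffles of `π` and `σ` correspond to pairs
of such biwords over `π` and over `σ`. -/
theorem sum_antidiagonal_ncard_cyclicOver {π σ : CyclicPerm} (hd : π.Disjoint σ) (d : ℕ+ →₀ ℕ) :
    ∑ x ∈ Finset.HasAntidiagonal.antidiagonal d, (cyclicOver π x.1).ncard * (cyclicOver σ x.2).ncard =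
      ∑ τ ∈ π.shuffle σ, (cyclicOver τ d).ncard := by
  let K : CyclicPerm → (ℕ+ →₀ ℕ) → Finset (List (ℕ+ ×ₗ ℕ+)) :=
    fun π d => (cyclicOver_finite π d).toFinset
  have hK : ∀ π d, (cyclicOver π d).ncard = (K π d).card := fun π d =>
    Set.ncard_eq_toFinset_card _ _
  have hmem : ∀ π d L, L ∈ K π d ↔ L ∈ cyclicOver π d := fun π d L => Set.Finite.mem_toFinset _
  simp_rw [hK, ← Finset.card_product]
  rw [← Finset.card_sigma, ← Finset.card_sigma]
  symm
  let f : List (ℕ+ ×ₗ ℕ+) → List (ℕ+ ×ₗ ℕ+) := fun L => L.filter fun e => (ofLex e).2 ∈ π.letters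
  let g : List (ℕ+ ×ₗ ℕ+) → List (ℕ+ ×ₗ ℕ+) := fun L => L.filter fun e => (ofLex e).2 ∈ σ.letters
  -- Each letter of a shuffle belongs to exactly one of `π` and `σ`, so the two filters are
  -- complementary.
  have hperm : ∀ τ ∈ π.shuffle σ, ∀ d, ∀ L ∈ cyclicOver τ d, (f L ++ g L).Perm L := by
    intro τ hτ d L hL
    have hg : g L = L.filter fun e => !decide ((ofLex e).2 ∈ π.letters) := by
      refine List.filter_congr fun e he => ?_
      have h1 := (labels_mem_letters_iff hL _).1 (mem_labels he)
      rw [((CyclicPerm.mem_shuffle_iff hd).1 hτ).2.2] at h1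
      by_cases h2 : (ofLex e).2 ∈ π.letters
      · have h3 : (ofLex e).2 ∉ σ.letters := hd _ h2
        simp [h2, h3]
      · simp [h2, h1.resolve_left h2]
    rw [hg]
    exact List.filter_append_perm _ L
  refine Finset.card_bij (fun y _ => ⟨(weight (f y.2), weight (g y.2)), (f y.2, g y.2)⟩) ?_ ?_ ?_
  · rintro ⟨τ, L⟩ h
    obtain ⟨hτ, hL⟩ := Finset.mem_sigma.1 h
    rw [hmem] at hL
    obtain ⟨h1, h2, -⟩ := (CyclicPerm.mem_shuffle_iff hd).1 hτ
    rw [Finset.mem_sigma, Finset.mem_product, hmem, hmem, Finset.HasAntidiagonal.mem_antidiagonal]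
    refine ⟨?_, ⟨?_, ?_, rfl⟩, ⟨?_, ?_, rfl⟩⟩
    · rw [← weight_append, weight_eq_of_perm (hperm τ hτ d L hL)]
      exact hL.2.2
    · exact (List.Pairwise.filter _ hL.1.pairwise).sortedLT
    · rw [← h1, ← hL.2.1, CyclicPerm.restrict_coe, ← labels_filter]
    · exact (List.Pairwise.filter _ hL.1.pairwise).sortedLT
    · rw [← h2, ← hL.2.1, CyclicPerm.restrict_coe, ← labels_filter]
  · rintro ⟨τ, L⟩ h ⟨τ', L'⟩ h' heq
    obtain ⟨hτ, hL⟩ := Finset.mem_sigma.1 h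
    obtain ⟨hτ', hL'⟩ := Finset.mem_sigma.1 h'
    rw [hmem] at hL hL'
    obtain ⟨hf, hg⟩ := Prod.ext_iff.1 (eq_of_heq (Sigma.ext_iff.1 heq).2)
    -- Both biwords are the sorted arrangement of the same pairs; the shuffle is then read off from
    -- the labels.
    have hLL : L = L' := by
      refine eq_of_sortedLT_of_perm hL.1 hL'.1 ?_
      have h1 := hperm τ hτ d L hL
      have h2 := hperm τ' hτ' d L' hL'
      simp only at hf hg
      rw [hf, hg] at h1
      exact h1.symm.trans h2
    subst hLL
    obtain rfl : τ = τ' := Subtype.ext (hL.2.1.symm.trans hL'.2.1)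
    rfl
  · rintro ⟨⟨d₁, d₂⟩, ⟨L₁, L₂⟩⟩ h
    rw [Finset.mem_sigma, Finset.mem_product, hmem, hmem, Finset.HasAntidiagonal.mem_antidiagonal] at h
    obtain ⟨hsum, hL₁, hL₂⟩ := h
    simp only at hsum hL₁ hL₂
    have hm₁ := fun e (he : e ∈ L₁) => (labels_mem_letters_iff hL₁ _).1 (mem_labels he)
    have hm₂ := fun e (he : e ∈ L₂) => (labels_mem_letters_iff hL₂ _).1 (mem_labels he)
    -- The preimage is the sorted merge. It is strictly increasing since disjointness of the labels
    -- prevents repeated pairs.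
    let L := (L₁ ++ L₂).insertionSort (· ≤ ·)
    have hLp : L.Perm (L₁ ++ L₂) := List.perm_insertionSort _ _
    have hnd : (L₁ ++ L₂).Nodup := List.nodup_append'.2 ⟨hL₁.1.nodup, hL₂.1.nodup,
      fun e he he' => hd _ (hm₁ e he) (hm₂ e he')⟩
    have hLs : L.SortedLT := by
      have h1 : L.SortedLE := (List.pairwise_insertionSort (· ≤ ·) (L₁ ++ L₂)).sortedLE
      exact h1.sortedLT_of_nodup (hLp.nodup_iff.2 hnd)
    have hfL : f L = L₁ := by
      refine eq_of_sortedLT_of_perm (List.Pairwise.filter _ hLs.pairwise).sortedLT hL₁.1 ?_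
      have h0 : L₂.filter (fun e => decide ((ofLex e).2 ∈ π.letters)) = [] :=
        List.filter_eq_nil_iff.2 fun e he h => hd _
          (show (ofLex e).2 ∈ π.letters by simpa using h) (hm₂ e he)
      have h1 := hLp.filter fun e => decide ((ofLex e).2 ∈ π.letters)
      rw [List.filter_append, List.filter_eq_self.2 fun e he => decide_eq_true (hm₁ e he),
        h0, List.append_nil] at h1
      exact h1
    have hgL : g L = L₂ := by
      refine eq_of_sortedLT_of_perm (List.Pairwise.filter _ hLs.pairwise).sortedLT hL₂.1 ?_
      have h0 : L₁.filter (fun e => decide ((ofLex e).2 ∈ σ.letters)) = [] :=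
        List.filter_eq_nil_iff.2 fun e he h => hd _ (hm₁ e he)
          (show (ofLex e).2 ∈ σ.letters by simpa using h)
      have h1 := hLp.filter fun e => decide ((ofLex e).2 ∈ σ.letters)
      rw [List.filter_append, h0,
        List.filter_eq_self.2 fun e he => decide_eq_true (hm₂ e he), List.nil_append] at h1
      exact h1
    have hlab : (labels L).Perm (labels L₁ ++ labels L₂) := by
      rw [labels, labels, labels, ← List.map_append]
      exact hLp.map _
    have hn₁ : (labels L₁).Nodup := by
      have := π.2
      rw [← hL₁.2.1] at this
      exact this
    have hn₂ : (labels L₂).Nodup := by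
      have := σ.2
      rw [← hL₂.2.1] at this
      exact this
    have hlnd : (labels L).Nodup := by
      refine hlab.nodup_iff.2 (List.nodup_append'.2 ⟨hn₁, hn₂, fun x hx hx' => ?_⟩)
      exact hd x ((labels_mem_letters_iff hL₁ x).1 hx) ((labels_mem_letters_iff hL₂ x).1 hx')
    have hτ : CyclicPerm.mk (labels L) hlnd ∈ π.shuffle σ := by
      refine (CyclicPerm.mem_shuffle_iff hd).2 ⟨?_, ?_, ?_⟩
      · show CyclicPerm.restrict _ (labels L : Cycle ℕ+) = _
        rw [CyclicPerm.restrict_coe, ← labels_filter, ← hL₁.2.1, ← hfL]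
      · show CyclicPerm.restrict _ (labels L : Cycle ℕ+) = _
        rw [CyclicPerm.restrict_coe, ← labels_filter, ← hL₂.2.1, ← hgL]
      · ext x
        show x ∈ labels L ↔ _
        rw [hlab.mem_iff, List.mem_append, labels_mem_letters_iff hL₁,
          labels_mem_letters_iff hL₂, Set.mem_union]
    refine ⟨⟨CyclicPerm.mk (labels L) hlnd, L⟩, Finset.mem_sigma.2 ⟨hτ, (hmem _ _ _).2
      ⟨hLs, rfl, ?_⟩⟩, ?_⟩
    · rw [weight_eq_of_perm hLp, weight_append, hL₁.2.2, hL₂.2.2, hsum]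
    · simp only [hfL, hgL, hL₁.2.2, hL₂.2.2]

end Biword

namespace CyclicPerm

/-- The product rule for fundamental cyclic quasisymmetric functions. -/
theorem cyclicQSym_mul {π σ : CyclicPerm} (hd : π.Disjoint σ) :
    π.cyclicQSym * σ.cyclicQSym = ∑ τ ∈ π.shuffle σ, τ.cyclicQSym := by
  classical
  ext d
  rw [MvPowerSeries.coeff_mul, map_sum]
  simp_rw [coeff_cyclicQSym]
  exact_mod_cast Biword.sum_antidiagonal_ncard_cyclicOver hd d

end CyclicPerm

/-! ### Rotations and cyclic descent sets -/

theorem mem_cDesList_rotate_iff (p : List ℕ+) (k : ℕ) {j : ℕ} (hj : j ∈ Finset.Icc 1 p.length) :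
    j ∈ cDesList (p.rotate k) ↔ (j + k - 1) % p.length + 1 ∈ cDesList p := by
  rw [Finset.mem_Icc] at hj
  have hn : 0 < p.length := by omega
  have h1 : (j + k - 1) % p.length < p.length := Nat.mod_lt _ hn
  have h2 : j % p.length < p.length := Nat.mod_lt _ hn
  have e1 : ((j + k - 1) % p.length + 1) % p.length = (j % p.length + k) % p.length := by
    rw [Nat.mod_add_mod, Nat.mod_add_mod]
    congr 1
    omega
  have e2 : j - 1 + k = j + k - 1 := by omega
  have hget : ∀ i, i < p.length → (p.rotate k).getD i 1 = p.getD ((i + k) % p.length) 1 := by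
    intro i hi
    rw [List.getD_eq_getElem _ _ (by simpa using hi), List.getElem_rotate,
      List.getD_eq_getElem _ _ (Nat.mod_lt _ hn)]
  unfold cDesList
  rw [Finset.mem_filter, Finset.mem_filter, List.length_rotate, Finset.mem_Icc, Finset.mem_Icc,
    Nat.add_sub_cancel, e1, hget _ h2, hget _ (by omega), e2]
  exact and_congr_left fun _ => ⟨fun _ => ⟨by omega, by omega⟩, fun _ => hj⟩

theorem cDesList_subset_Icc (p : List ℕ+) : cDesList p ⊆ Finset.Icc 1 p.length :=
  Finset.filter_subset _ _

theorem cyclicShift_cDesList_rotate (p : List ℕ+) (k : ℕ) :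
    cyclicShift p.length (cDesList (p.rotate k)) k = cDesList p := by
  ext i
  unfold cyclicShift
  rw [Finset.mem_image]
  constructor
  · rintro ⟨j, hj, rfl⟩
    have hj' := cDesList_subset_Icc _ hj
    rw [List.length_rotate] at hj'
    exact (mem_cDesList_rotate_iff p k hj').1 hj
  · intro hi
    have hi' := Finset.mem_Icc.1 (cDesList_subset_Icc _ hi)
    have hn : 0 < p.length := by omega
    have hk : k % p.length < p.length := Nat.mod_lt _ hn
    -- The position `i - k` modulo the length; reducing `k` first keeps the truncated subtraction
    -- exact.
    let j := (i - 1 + (p.length - k % p.length)) % p.length + 1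
    have hlt : (i - 1 + (p.length - k % p.length)) % p.length < p.length := Nat.mod_lt _ hn
    have hj : j ∈ Finset.Icc 1 p.length := Finset.mem_Icc.2 ⟨by omega, by omega⟩
    have hji : (j + k - 1) % p.length + 1 = i := by
      have e1 : j + k - 1 = (i - 1 + (p.length - k % p.length)) % p.length + k := by omega
      have e2 : i - 1 + (p.length - k % p.length) + k % p.length = i - 1 + p.length := by omega
      rw [e1, Nat.mod_add_mod, Nat.add_mod, ← Nat.add_mod, ← Nat.add_mod_mod, e2,
        Nat.add_mod_right, Nat.mod_eq_of_lt (by omega)]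
      omega
    exact ⟨j, (mem_cDesList_rotate_iff p k hj).2 (hji.symm ▸ hi), hji⟩

theorem cDesList_rotate {p : List ℕ+} {k : ℕ} (hk : k ≤ p.length) :
    cDesList (p.rotate (p.length - k)) = cyclicShift p.length (cDesList p) k := by
  have h := cyclicShift_cDesList_rotate (p.rotate (p.length - k)) k
  rw [List.rotate_rotate, Nat.sub_add_cancel hk, List.rotate_length, List.length_rotate] at h
  exact h.symm

theorem card_cDesList_eq_of_isRotated {p q : List ℕ+} (h : p.IsRotated q) :
    (cDesList p).card = (cDesList q).card := by
  have aux : ∀ {p q : List ℕ+}, p.IsRotated q → (cDesList p).card ≤ (cDesList q).card := by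
    rintro p q ⟨k, rfl⟩
    conv_lhs => rw [← cyclicShift_cDesList_rotate p k]
    exact Finset.card_image_le
  exact (aux h).antisymm (aux h.symm)

/-- The cyclic descent set of `[p]` is the class of the cyclic descent set of `p`. -/
theorem cDes_mk {p : List ℕ+} (hp : p.Nodup) :
    cDes (CyclicPerm.mk p hp) = shiftClass p.length (cDesList p) := by
  unfold cDes shiftClass
  show (Cycle.lists (p : Cycle ℕ+)).map cDesList = _
  rw [Cycle.lists_coe]
  split_ifs with h
  · obtain rfl := List.length_eq_zero_iff.1 h
    rfl
  · have hp0 : p ≠ [] := fun h' => h (by rw [h']; rfl)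
    have h1 : p.cyclicPermutations = (List.range p.length).map p.rotate := by
      refine List.ext_getElem (by simp [List.length_cyclicPermutations_of_ne_nil _ hp0]) ?_
      intro n _ _
      simp [List.getElem_cyclicPermutations]
    -- Rotating left by `n - i` shifts the descent set by `i`, so the rotations by `0, …, n-1` are
    -- reindexed by the shifts `n, …, 1`.
    have h2 : (List.range p.length : Multiset ℕ) =
        (Finset.Icc 1 p.length).val.map (p.length - ·) := by
      refine (Multiset.Nodup.ext (Multiset.coe_nodup.2 List.nodup_range)
        (Multiset.Nodup.map_on ?_ (Finset.nodup _))).2 fun a => ?_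
      · intro a ha b hb hab
        have ha := Finset.mem_Icc.1 (show _ ∈ Finset.Icc 1 p.length from ha)
        have hb := Finset.mem_Icc.1 (show _ ∈ Finset.Icc 1 p.length from hb)
        omega
      · simp only [Multiset.mem_coe, List.mem_range, Multiset.mem_map, Finset.mem_val,
          Finset.mem_Icc]
        exact ⟨fun ha => ⟨p.length - a, by omega, by omega⟩, by rintro ⟨b, hb, rfl⟩; omega⟩
    rw [h1, ← Multiset.map_coe, h2, Multiset.map_map, Multiset.map_map]
    refine Multiset.map_congr rfl fun k hk => ?_
    exact cDesList_rotate (Finset.mem_Icc.1 (show _ ∈ Finset.Icc 1 p.length from hk)).2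

/-- Some rotation of a permutation of length at least two has a descent at the end. -/
theorem exists_rotate_length_mem_cDesList {p : List ℕ+} (hp : p.Nodup) (h : 2 ≤ p.length) :
    ∃ k, p.length ∈ cDesList (p.rotate k) := by
  have hne : p.toFinset.Nonempty := by
    rw [List.toFinset_nonempty_iff]
    rintro rfl
    simp at h
  -- Rotate the smallest letter to the front: the last letter then exceeds its cyclic successor.
  obtain ⟨m, hm, hmin⟩ := Finset.exists_min_image p.toFinset id hne
  obtain ⟨k, hk, rfl⟩ := List.getElem_of_mem (List.mem_toFinset.1 hm)
  refine ⟨k, Finset.mem_filter.2 ⟨Finset.mem_Icc.2 ?_, ?_⟩⟩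
  · rw [List.length_rotate]
    omega
  · have hl : (p.rotate k).length = p.length := List.length_rotate _ _
    have hn : (p.rotate k).Nodup := List.nodup_rotate.2 hp
    rw [hl, Nat.mod_self, List.getD_eq_getElem _ _ (by omega), List.getD_eq_getElem _ _ (by omega)]
    have e : (p.rotate k)[0]'(by omega) = p[k] := by
      rw [List.getElem_rotate]
      simp [Nat.mod_eq_of_lt hk]
    refine lt_of_le_of_ne ?_ fun h' => ?_
    · rw [e]
      refine hmin _ (List.mem_toFinset.2 ?_)
      exact List.mem_rotate.1 (List.getElem_mem _)
    · have := (List.Nodup.getElem_inj_iff hn).1 h'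
      omega

theorem cDesList_eq_empty {p : List ℕ+} (h : p.length ≤ 1) : cDesList p = ∅ := by
  refine Finset.filter_eq_empty_iff.2 fun i hi => ?_
  obtain ⟨h1, h2⟩ := Finset.mem_Icc.1 hi
  have h3 : p.length = 1 := by omega
  have h4 : i = 1 := by omega
  simp [h3, h4]

/-! ### A monomial that bounds descent sets -/

namespace Biword

theorem map_fst_sortedLE {L : List (ℕ+ ×ₗ ℕ+)} (h : L.SortedLT) :
    (L.map fun e => (ofLex e).1).SortedLE := by
  refine (List.pairwise_map.2 (h.pairwise.imp fun {a b} hab => ?_)).sortedLE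
  rcases Prod.Lex.lt_iff.1 hab with h | h
  · exact h.le
  · exact h.1.le

/-- There is a monomial that occurs in the fundamental quasisymmetric function of `p`, and in that
of another permutation only if its descents are descents of `p`. -/
theorem exists_weight_descents_subset {p : List ℕ+} (hp : p.Nodup) :
    ∃ d, (sortedOver p d).Nonempty ∧ ∀ q : List ℕ+, (sortedOver q d).Nonempty →
      q.length = p.length ∧ ∀ a, a + 1 < q.length → a + 1 ∈ cDesList q → a + 1 ∈ cDesList p := by
  -- The slowest admissible index sequence: at the entry of index `a`, count the descents at
  -- positions up to `a`. It rises from `a` to `a + 1` exactly when `a + 1` is a cyclic descent;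
  -- `Nat.succPNat` makes the values positive.
  let c : ℕ → ℕ := fun a => ((cDesList p).filter (· ≤ a)).card
  have hc : Monotone c := fun a b hab => Finset.card_le_card
    (Finset.monotone_filter_right _ fun x _ hx => le_trans hx hab)
  let L : List (ℕ+ ×ₗ ℕ+) :=
    List.ofFn fun a : Fin p.length => toLex (Nat.succPNat (c a), p.get a)
  have hL : L.SortedLT := by
    refine List.sortedLT_ofFn_iff.2 ((strictMono_toLex_iff
      (List.nodup_iff_injective_get.1 hp)).2 ⟨fun a b hab => ?_, fun a b hab h => ?_⟩)
    · exact Nat.succPNat_le_succPNat.2 (hc hab)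
    · have hb : (a : ℕ) + 1 < p.length := hab ▸ b.2
      refine Nat.succPNat_lt_succPNat.2 (Finset.card_lt_card ?_)
      refine Finset.ssubset_iff_of_subset
        (Finset.monotone_filter_right _ fun x _ hx => by omega) |>.2 ⟨b, ?_, ?_⟩
      · refine Finset.mem_filter.2 ⟨?_, le_rfl⟩
        rw [hab, mem_cDesList_iff hb]
        simpa [hab] using h
      · rw [Finset.mem_filter]
        omega
  refine ⟨weight L, ⟨L, hL, ?_, rfl⟩, ?_⟩
  · rw [labels, List.map_ofFn]
    exact List.ofFn_get p
  · rintro q ⟨M, hM, rfl, hw⟩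
    -- The first components of an increasing biword are weakly increasing, so the weight alone
    -- determines their sequence.
    have hmap : (M.map fun e => (ofLex e).1) = L.map fun e => (ofLex e).1 :=
      (Multiset.coe_eq_coe.1 (Multiset.toFinsupp.injective hw)).eq_of_sortedLE
        (map_fst_sortedLE hM) (map_fst_sortedLE hL)
    have hlen : M.length = p.length := by
      have := congrArg List.length hmap
      simpa [L] using this
    refine ⟨by rw [length_labels, hlen], fun a ha hdes => ?_⟩
    rw [mem_cDesList_iff ha] at hdes
    rw [length_labels] at ha
    have hfst : ∀ b (hb : b < M.length), (ofLex M[b]).1 = Nat.succPNat (c b) := by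
      intro b hb
      have h1 : (M.map fun e => (ofLex e).1)[b]'(by simpa using hb) =
          (L.map fun e => (ofLex e).1)[b]'(by simpa [L, ← hlen] using hb) := by
        simp only [hmap]
      simpa [L] using h1
    have hlt : M[a] < M[a + 1] :=
      hM.getElem_lt_getElem_of_lt (Nat.lt_succ_self a)
    by_contra hnot
    -- Without a descent of `p` here the two indices agree, and lexicographic increase then forces
    -- an ascent of the labels.
    have hcc : c (a + 1) = c a := by
      refine congrArg Finset.card (Finset.filter_congr fun x hx => ?_)
      have : x ≠ a + 1 := fun h => hnot (h ▸ hx)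
      omega
    rcases Prod.Lex.lt_iff.1 hlt with h | h
    · rw [hfst, hfst, hcc] at h
      exact lt_irrefl _ h
    · have h3 : (labels M)[a]'(by rw [length_labels]; omega) <
          (labels M)[a + 1]'(by rw [length_labels]; omega) := by
        simpa [labels] using h.2
      exact hdes.asymm h3

end Biword

/-! ### Linear independence and the isomorphism -/

/-- The fundamental cyclic quasisymmetric function attached to a `cDes`-equivalence class. -/
noncomputable def classQSym : cDesStat.EqClass → MvPowerSeries ℕ+ ℚ :=
  Quotient.lift CyclicPerm.cyclicQSym fun π σ (h : cDes π = cDes σ ∧ π.length = σ.length) => by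
    rw [CyclicPerm.cyclicQSym, CyclicPerm.cyclicQSym, h.1, h.2]

theorem classQSym_eqClass (π : CyclicPerm) : classQSym (cDesStat.eqClass π) = π.cyclicQSym := rfl

theorem eqClass_mk_eq {p q : List ℕ+} (hp : p.Nodup) (hq : q.Nodup) (hl : p.length = q.length)
    (h : cDesList p = cDesList q) :
    cDesStat.eqClass (CyclicPerm.mk p hp) = cDesStat.eqClass (CyclicPerm.mk q hq) := by
  refine (cDesStat.eqClass_eq).2 ⟨?_, hl⟩
  show cDes (CyclicPerm.mk p hp) = cDes (CyclicPerm.mk q hq)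
  rw [cDes_mk, cDes_mk, hl, h]

theorem CyclicPerm.mk_rotate {p : List ℕ+} (hp : p.Nodup) (k : ℕ) :
    mk (p.rotate k) (List.nodup_rotate.2 hp) = mk p hp :=
  Subtype.ext (Cycle.coe_eq_coe.2 (List.IsRotated.forall p k))

/-- In a nontrivial relation, take a class with the fewest cyclic descents and the monomial of
`exists_weight_descents_subset` for a suitable representative `p`. Any class in the relation whose
function contains this monomial has a representative with cyclic descent set inside that of `p`,
hence equal to it by minimality. So the monomial isolates one coefficient. -/
theorem linearIndependent_classQSym : LinearIndependent ℚ classQSym := by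
  classical
  refine linearIndependent_iff.2 fun c hc => ?_
  by_contra hne
  have hex : ∃ k, ∃ (p : List ℕ+) (hp : p.Nodup),
      cDesStat.eqClass (CyclicPerm.mk p hp) ∈ c.support ∧ (cDesList p).card = k := by
    obtain ⟨α, hα⟩ := Finsupp.support_nonempty_iff.2 hne
    induction α using Quotient.inductionOn with
    | h π =>
      obtain ⟨p, hp, rfl⟩ := CyclicPerm.exists_rep π
      exact ⟨_, p, hp, hα, rfl⟩
  -- The monomial gives no control over position `n`, so `p` is rotated to have a descent there;
  -- rotation preserves both the class and the number of cyclic descents.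
  obtain ⟨p, hp, hpc, hcard, htop⟩ : ∃ (p : List ℕ+) (hp : p.Nodup),
      cDesStat.eqClass (CyclicPerm.mk p hp) ∈ c.support ∧ (cDesList p).card = Nat.find hex ∧
        (2 ≤ p.length → p.length ∈ cDesList p) := by
    obtain ⟨p, hp, h1, h2⟩ := Nat.find_spec hex
    by_cases h : 2 ≤ p.length
    · obtain ⟨k, hk⟩ := exists_rotate_length_mem_cDesList hp h
      refine ⟨p.rotate k, List.nodup_rotate.2 hp, ?_, ?_, fun _ => ?_⟩
      · rwa [CyclicPerm.mk_rotate hp]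
      · rw [← h2]
        exact card_cDesList_eq_of_isRotated (List.IsRotated.forall p k)
      · rwa [List.length_rotate]
    · exact ⟨p, hp, h1, h2, fun h' => absurd h' h⟩
  have hmin : ∀ (q : List ℕ+) (hq : q.Nodup),
      cDesStat.eqClass (CyclicPerm.mk q hq) ∈ c.support →
        (cDesList p).card ≤ (cDesList q).card :=
    fun q hq h => hcard ▸ Nat.find_min' hex ⟨q, hq, h, rfl⟩
  obtain ⟨d, ⟨L, hL⟩, hd⟩ := Biword.exists_weight_descents_subset hp
  have hcoeff := congrArg (MvPowerSeries.coeff d) hc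
  rw [Finsupp.linearCombination_apply, Finsupp.sum, map_sum, map_zero,
    Finset.sum_eq_single (cDesStat.eqClass (CyclicPerm.mk p hp))] at hcoeff
  · rw [map_smul, classQSym_eqClass, CyclicPerm.coeff_cyclicQSym, smul_eq_mul, mul_eq_zero] at hcoeff
    rcases hcoeff with h | h
    · exact Finsupp.mem_support_iff.1 hpc h
    · rw [Nat.cast_eq_zero, Set.ncard_eq_zero (Biword.cyclicOver_finite _ _)] at h
      have : L ∈ Biword.cyclicOver (CyclicPerm.mk p hp) d :=
        ⟨hL.1, by rw [hL.2.1]; rfl, hL.2.2⟩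
      rw [h] at this
      exact this
  · intro β hβ hβne
    induction β using Quotient.inductionOn with
    | h σ =>
      rw [map_smul]
      refine smul_eq_zero_of_right _ ((CyclicPerm.coeff_cyclicQSym σ d).trans ?_)
      rw [Nat.cast_eq_zero, Set.ncard_eq_zero (Biword.cyclicOver_finite _ _)]
      refine Set.eq_empty_iff_forall_notMem.2 fun M hM => hβne ?_
      have hq : (Biword.labels M).Nodup := by
        have := σ.2
        rwa [← hM.2.1] at this
      have hσ : σ = CyclicPerm.mk (Biword.labels M) hq := Subtype.ext hM.2.1.symm
      subst hσ
      obtain ⟨hlen, hsub⟩ := hd _ ⟨M, hM.1, rfl, hM.2.2⟩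
      -- Descents before the last position are controlled by `hsub`, the last one by `htop`; words
      -- of length at most one have none.
      refine eqClass_mk_eq hq hp hlen (Finset.eq_of_subset_of_card_le ?_ (hmin _ hq hβ))
      intro i hi
      have hi' := Finset.mem_Icc.1 (cDesList_subset_Icc _ hi)
      by_cases h2 : 2 ≤ p.length
      · rcases hi'.2.lt_or_eq with h | h
        · obtain ⟨a, rfl⟩ := Nat.exists_eq_add_of_le' hi'.1
          exact hsub a h hi
        · rw [h, hlen]
          exact htop h2
      · rw [cDesList_eq_empty (by omega)] at hi
        exact absurd hi (Finset.notMem_empty i)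
  · exact fun h => absurd hpc h

theorem linearCombination_shuffleSum {π σ : CyclicPerm} (hd : π.Disjoint σ) :
    Finsupp.linearCombination ℚ classQSym (cDesStat.shuffleSum π σ) =
      π.cyclicQSym * σ.cyclicQSym := by
  rw [CyclicPerm.cyclicQSym_mul hd, CyclicStatistic.shuffleSum, map_sum]
  refine Finset.sum_congr rfl fun τ _ => ?_
  rw [Finsupp.linearCombination_single, one_smul, classQSym_eqClass]

/-- The formal sum of shuffle classes maps to a product of series depending only on the classes of
the factors, and independence makes that map injective. -/
theorem isCyclicShuffleCompatible_cDesStat : cDesStat.IsCyclicShuffleCompatible := by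
  classical
  intro π σ π' σ' hd hd' h1 h2 h3 h4
  have hπ : π.cyclicQSym = π'.cyclicQSym :=
    congrArg classQSym (cDesStat.eqClass_eq.2 ⟨h1, h3⟩)
  have hσ : σ.cyclicQSym = σ'.cyclicQSym :=
    congrArg classQSym (cDesStat.eqClass_eq.2 ⟨h2, h4⟩)
  have hsum : cDesStat.shuffleSum π σ = cDesStat.shuffleSum π' σ' := by
    refine linearIndependent_classQSym ?_
    rw [linearCombination_shuffleSum hd, linearCombination_shuffleSum hd', hπ, hσ]
  -- The coefficients of the formal sum are multiplicities, so equality of sums over `ℚ` gives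
  -- equality of multisets of classes.
  have hcount : ∀ (π σ : CyclicPerm) (α : cDesStat.EqClass), cDesStat.shuffleSum π σ α =
      (((π.shuffle σ).val.map cDesStat.eqClass).count α : ℚ) := by
    intro π σ α
    rw [CyclicStatistic.shuffleSum, Finsupp.finsetSum_apply, Multiset.count_map]
    simp_rw [Finsupp.single_apply]
    rw [Finset.sum_boole]
    simp_rw [eq_comm (a := α)]
    rfl
  have hmap : (π.shuffle σ).val.map cDesStat.eqClass =
      (π'.shuffle σ').val.map cDesStat.eqClass := by
    refine Multiset.ext.2 fun α => ?_
    have := DFunLike.congr_fun hsum α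
    rw [hcount, hcount] at this
    exact_mod_cast this
  let val : cDesStat.EqClass → Multiset (Finset ℕ) := Quotient.lift cDesStat.toFun fun _ _ h => h.1
  have := congrArg (Multiset.map val) hmap
  rw [Multiset.map_map, Multiset.map_map] at this
  exact this

/-! ### The algebra isomorphism -/

namespace CyclicStatistic.ShuffleAlgebra

/-- The linear map from the cyclic shuffle algebra of `cDes` to power series. -/
noncomputable def toPowerSeriesLin :
    ShuffleAlgebra isCyclicShuffleCompatible_cDesStat →ₗ[ℚ] MvPowerSeries ℕ+ ℚ :=
  Finsupp.linearCombination ℚ classQSym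

theorem toPowerSeriesLin_of (π : CyclicPerm) :
    toPowerSeriesLin (of isCyclicShuffleCompatible_cDesStat π) = π.cyclicQSym :=
  (Finsupp.linearCombination_single ℚ 1 (cDesStat.eqClass π)).trans (one_smul _ _)

theorem toPowerSeriesLin_one : toPowerSeriesLin 1 = 1 :=
  toPowerSeriesLin_of CyclicPerm.empty

theorem toPowerSeriesLin_mul (x y : ShuffleAlgebra isCyclicShuffleCompatible_cDesStat) :
    toPowerSeriesLin (x * y) = toPowerSeriesLin x * toPowerSeriesLin y := by
  have e : (mulLin isCyclicShuffleCompatible_cDesStat).compr₂ toPowerSeriesLin =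
      (LinearMap.mul ℚ (MvPowerSeries ℕ+ ℚ)).compl₁₂ toPowerSeriesLin toPowerSeriesLin := by
    refine lin_ext _ fun π => lin_ext _ fun σ => ?_
    -- The multiplication rule applies only to disjoint permutations, so representatives are
    -- replaced within their classes.
    obtain ⟨⟨π', σ'⟩, h1, h2, hd⟩ :=
      cDesStat.exists_disjoint₂ (cDesStat.eqClass π) (cDesStat.eqClass σ)
    have e1 : of isCyclicShuffleCompatible_cDesStat π = of _ π' := by unfold of; rw [← h1]
    have e2 : of isCyclicShuffleCompatible_cDesStat σ = of _ σ' := by unfold of; rw [← h2]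
    rw [LinearMap.compr₂_apply, LinearMap.compl₁₂_apply, LinearMap.mul_apply', e1, e2,
      mulLin_of _ hd, map_sum, toPowerSeriesLin_of, toPowerSeriesLin_of,
      CyclicPerm.cyclicQSym_mul hd]
    exact Finset.sum_congr rfl fun τ _ => toPowerSeriesLin_of τ
  exact LinearMap.congr_fun (LinearMap.congr_fun e x) y

/-- The algebra homomorphism from the cyclic shuffle algebra of `cDes` to power series. -/
noncomputable def toPowerSeries :
    ShuffleAlgebra isCyclicShuffleCompatible_cDesStat →ₐ[ℚ] MvPowerSeries ℕ+ ℚ :=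
  AlgHom.ofLinearMap toPowerSeriesLin toPowerSeriesLin_one toPowerSeriesLin_mul

theorem toPowerSeries_of (π : CyclicPerm) :
    toPowerSeries (of isCyclicShuffleCompatible_cDesStat π) = π.cyclicQSym :=
  toPowerSeriesLin_of π

theorem toPowerSeries_injective : Function.Injective toPowerSeries :=
  linearIndependent_classQSym

/-- The two spanning sets coincide: a non-Escher set is the cyclic descent set of some `p`, and its
shift class is then `cDes` of `[p]`. -/
theorem range_toPowerSeries : Subalgebra.toSubmodule toPowerSeries.range = cQSymMinus := by
  have h1 : Subalgebra.toSubmodule toPowerSeries.range =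
      Submodule.span ℚ (Set.range classQSym) :=
    Finsupp.range_linearCombination (R := ℚ) (v := classQSym)
  rw [h1, cQSymMinus]
  congr 1
  ext f
  constructor
  · rintro ⟨α, rfl⟩
    induction α using Quotient.inductionOn with
    | h π =>
      obtain ⟨p, hp, rfl⟩ := CyclicPerm.exists_rep π
      refine ⟨p.length, cDesList p, ⟨p, hp, rfl, rfl⟩, ?_⟩
      rw [← cDes_mk hp]
      rfl
  · rintro ⟨n, S, ⟨p, hp, rfl, rfl⟩, rfl⟩
    refine ⟨cDesStat.eqClass (CyclicPerm.mk p hp), ?_⟩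
    rw [← cDes_mk hp]
    rfl

end CyclicStatistic.ShuffleAlgebra

theorem theorem3p3 :
    (∀ (m n : ℕ) (A B : Finset ℕ), IsNonEscher m A → IsNonEscher n B →
      ∀ π σ : CyclicPerm, π.length = m → cDes π = shiftClass m A →
        σ.length = n → cDes σ = shiftClass n B → π.Disjoint σ →
        fundamentalCQSymClass m (shiftClass m A) * fundamentalCQSymClass n (shiftClass n B) =
          ∑ τ ∈ π.shuffle σ, fundamentalCQSymClass (m + n) (cDes τ)) ∧
    ∃ (h : cDesStat.IsCyclicShuffleCompatible) (Q : Subalgebra ℚ (MvPowerSeries ℕ+ ℚ)),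
      Subalgebra.toSubmodule Q = cQSymMinus ∧
      ∃ φ : CyclicStatistic.ShuffleAlgebra h ≃ₐ[ℚ] Q, ∀ π : CyclicPerm,
        (φ (CyclicStatistic.ShuffleAlgebra.of h π) : MvPowerSeries ℕ+ ℚ) =
          fundamentalCQSymClass π.length (cDes π) := by

  refine ⟨?_, isCyclicShuffleCompatible_cDesStat,
    CyclicStatistic.ShuffleAlgebra.toPowerSeries.range,
    CyclicStatistic.ShuffleAlgebra.range_toPowerSeries,
    AlgEquiv.ofInjective _ CyclicStatistic.ShuffleAlgebra.toPowerSeries_injective,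
    CyclicStatistic.ShuffleAlgebra.toPowerSeries_of⟩
  rintro m n A B - - π σ rfl hA rfl hB hd
  rw [← hA, ← hB]
  refine (CyclicPerm.cyclicQSym_mul hd).trans (Finset.sum_congr rfl fun τ hτ => ?_)
  rw [CyclicPerm.cyclicQSym, CyclicPerm.length_of_mem_shuffle hτ]
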